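/- Let $X$ be a compact complex manifold. Write $\mathcal A^{k}(X)$ for the smooth complex-valued $k$-forms on $X$, $\mathcal A^{p,q}(X)$ for those of type $(p,q)$, and $d=\partial+\bar\partial$. Suppose that $X$ satisfies the $\partial\bar\partial$-lemma, that is, \[\ker\partial\cap\ker\bar\partial\cap\operatorname{im} d=\operatorname{im}\partial\bar\partial\] on forms of every degree. Let \[H^{2,0}_{\bar\partial}(X)=\ker\big(\bar\partial:\mathcal A^{2,0}(X)\to\mathcal A^{2,1}(X)\big)\] be the Dolbeault cohomology space (there are no non-zero $\bar\partial$-exact $(2,0)$-forms), which is a finite-dimensional complex vector space and carries its usual topology. A complex symplectic form on $X$ is a $d$-closed $\sigma\in\mathcal A^{2,0}(X)$ that is non-degenerate on $T_xX$ for every $x\in X$. Let \[Sp(X)=\{[\sigma]\in H^{2,0}_{\bar\partial}(X)\mid\sigma\text{ is a complex symplectic form on }X\}.\] Then $Sp(X)$ is an open cone in $H^{2,0}_{\bar\partial}(X)$: it is an open subset, and $\lambda c\in Sp(X)$ for all $c\in Sp(X)$ and all $\lambda\in\mathbb C\setminus\{0\}$. -/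

import Mathlib

open scoped Manifold ContDiff Topology

noncomputable section

namespace ComplexForms

open ContinuousAlternatingMap

/-! ### Local theory: complex valued forms on a complex normed space -/

section Local

variable {V W : Type*} [NormedAddCommGroup V] [NormedSpace ℂ V]
  [NormedAddCommGroup W] [NormedSpace ℂ W] {k : ℕ}

/-- Multiplication by the complex number `c` on `V`, as a real linear map. -/
def cmul (V : Type*) [NormedAddCommGroup V] [NormedSpace ℂ V] (c : ℂ) : V →L[ℝ] V :=
  (c • ContinuousLinearMap.id ℂ V).restrictScalars ℝ

@[simp] theorem cmul_apply (c : ℂ) (v : V) : cmul V c v = c • v := rfl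

/-- The real linear map `v ↦ a L(v) + b L(i v)`. For `(a, b) = (1/2, -i/2)` this is the complex
linear part of `L`, and for `(a, b) = (1/2, i/2)` it is the complex antilinear part of `L`. -/
def twist (a b : ℂ) (L : V →L[ℝ] W) : V →L[ℝ] W :=
  a • L + b • L.comp (cmul V Complex.I)

@[simp] theorem twist_apply (a b : ℂ) (L : V →L[ℝ] W) (v : V) :
    twist a b L v = a • L v + b • L (Complex.I • v) := rfl

/-- The first order operator obtained by alternating `a Dβ(v) + b Dβ(i v)`, where `Dβ` is the real
derivative of the form `β`. It is the exterior derivative `d` for `(a, b) = (1, 0)`; it is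
`∂ = ∑ dz_j ∧ ∂/∂z_j` for `(a, b) = (1/2, -i/2)` (only the complex linear part of `Dβ` is used), and
it is `∂bar = ∑ dzbar_j ∧ ∂/∂zbar_j` for `(a, b) = (1/2, i/2)` (the complex antilinear part). -/
def extOp (a b : ℂ) (β : V → V [⋀^Fin k]→L[ℝ] ℂ) (y : V) : V [⋀^Fin (k + 1)]→L[ℝ] ℂ :=
  alternatizeUncurryFin (twist a b (fderiv ℝ β y))

theorem extOp_apply (a b : ℂ) (β : V → V [⋀^Fin k]→L[ℝ] ℂ) (y : V) (v : Fin (k + 1) → V) :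
    extOp a b β y v = ∑ i : Fin (k + 1), (-1 : ℤ) ^ (i : ℕ) •
      (a * fderiv ℝ β y (v i) (i.removeNth v) +
        b * fderiv ℝ β y (Complex.I • v i) (i.removeNth v)) := by
  simp [extOp, alternatizeUncurryFin_apply]

theorem extOp_one_zero (β : V → V [⋀^Fin k]→L[ℝ] ℂ) (y : V) :
    extOp 1 0 β y = extDeriv β y := by
  ext v
  simp [extOp, extDeriv, alternatizeUncurryFin_apply]

theorem extOp_congr {a b : ℂ} {β γ : V → V [⋀^Fin k]→L[ℝ] ℂ} {y : V} (h : β =ᶠ[𝓝 y] γ) :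
    extOp a b β y = extOp a b γ y := by
  simp only [extOp, h.fderiv_eq]

theorem extOp_eq (a b : ℂ) {β : V → V [⋀^Fin k]→L[ℝ] ℂ} {y : V} (hβ : DifferentiableAt ℝ β y) :
    extOp a b β y = a • extDeriv β y + b •
      (extDeriv (fun z => (β z).compContinuousLinearMap (cmul V (-Complex.I))) y
        ).compContinuousLinearMap (cmul V Complex.I) := by
  have h1 : fderiv ℝ (fun z => (β z).compContinuousLinearMap (cmul V (-Complex.I))) y
      = (compContinuousLinearMapCLM (cmul V (-Complex.I))).comp (fderiv ℝ β y) :=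
    ((compContinuousLinearMapCLM (𝕜 := ℝ) (F := ℂ) (ι := Fin k)
      (cmul V (-Complex.I))).hasFDerivAt.comp y hβ.hasFDerivAt).fderiv
  ext v
  rw [extOp_apply, ContinuousAlternatingMap.add_apply, ContinuousAlternatingMap.smul_apply,
    ContinuousAlternatingMap.smul_apply, compContinuousLinearMap_apply, extDeriv,
    extDeriv, h1, alternatizeUncurryFin_apply, alternatizeUncurryFin_apply, Finset.smul_sum,
    Finset.smul_sum, ← Finset.sum_add_distrib]
  refine Finset.sum_congr rfl fun i _ => ?_
  have h2 : (cmul V (-Complex.I)) ∘ (i.removeNth ((cmul V Complex.I) ∘ v)) = i.removeNth v := by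
    funext j
    simp [Fin.removeNth, smul_smul]
  have h3 : ((compContinuousLinearMapCLM (cmul V (-Complex.I))).comp (fderiv ℝ β y))
      (((cmul V Complex.I) ∘ v) i) (i.removeNth ((cmul V Complex.I) ∘ v))
      = fderiv ℝ β y (Complex.I • v i) (i.removeNth v) := by
    rw [← h2]; rfl
  rw [h3, smul_add, smul_comm a, smul_comm b]
  rfl

theorem extOp_pullback (a b : ℂ) {β : V → V [⋀^Fin k]→L[ℝ] ℂ} {f : V → V} {y : V}
    (hβ : DifferentiableAt ℝ β (f y)) (hf : ContDiffAt ℂ 2 f y) :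
    extOp a b (fun z => (β (f z)).compContinuousLinearMap (fderiv ℝ f z)) y =
      (extOp a b β (f y)).compContinuousLinearMap (fderiv ℝ f y) := by
  have hfR : ContDiffAt ℝ 2 f y := hf.restrict_scalars ℝ
  have hev : ∀ᶠ z in 𝓝 y, DifferentiableAt ℂ f z :=
    (hf.eventually (by simp)).mono fun z hz => hz.differentiableAt (by simp)
  have hcomm : ∀ (z : V), DifferentiableAt ℂ f z → ∀ (c : ℂ) (v : V),
      fderiv ℝ f z (c • v) = c • fderiv ℝ f z v := by
    intro z hz c v
    rw [hz.fderiv_restrictScalars ℝ]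
    simp
  have hd : DifferentiableAt ℝ
      (fun z => (β (f z)).compContinuousLinearMap (fderiv ℝ f z)) y := by
    have h1 : DifferentiableAt ℝ (fun z => β (f z)) y :=
      hβ.comp y (hfR.differentiableAt (by simp))
    have h2 : DifferentiableAt ℝ (fderiv ℝ f) y :=
      (hfR.fderiv_right (m := 1) (by norm_num)).differentiableAt (by simp)
    exact h1.continuousAlternatingMapCompContinuousLinearMap h2
  have hβ' : DifferentiableAt ℝ
      (fun w => (β w).compContinuousLinearMap (cmul V (-Complex.I))) (f y) :=
    (compContinuousLinearMapCLM (𝕜 := ℝ) (F := ℂ) (ι := Fin k)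
      (cmul V (-Complex.I))).differentiableAt.comp (f y) hβ
  have hrs : minSmoothness ℝ 2 ≤ (2 : WithTop ℕ∞) := by simp
  rw [extOp_eq a b hd, extOp_eq a b hβ, extDeriv_pullback hβ hfR hrs]
  have hcongr : (fun z => ((β (f z)).compContinuousLinearMap (fderiv ℝ f z)
        ).compContinuousLinearMap (cmul V (-Complex.I))) =ᶠ[𝓝 y]
      fun z => ((β (f z)).compContinuousLinearMap (cmul V (-Complex.I))
        ).compContinuousLinearMap (fderiv ℝ f z) := by
    filter_upwards [hev] with z hz
    ext v
    simp only [compContinuousLinearMap_apply]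
    congr 1
    funext j
    simp [hcomm z hz]
  have hpb := extDeriv_pullback hβ' hfR hrs
  rw [hcongr.extDeriv_eq, hpb]
  ext v
  simp only [compContinuousLinearMap_apply, ContinuousAlternatingMap.add_apply,
    ContinuousAlternatingMap.smul_apply]
  congr 3
  funext j
  simp [hcomm y hev.self_of_nhds]

/-- A real multilinear alternating form of degree `k = p + q` has type `(p, q)`: complex scalars
act on it through `c ^ p * conj c ^ q`. -/
def HasType {U : Type*} [AddCommGroup U] [Module ℂ U] [TopologicalSpace U] (p q : ℕ)
    (a : U [⋀^Fin k]→L[ℝ] ℂ) : Prop :=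
  ∀ (c : ℂ) (v : Fin k → U), a (fun i => c • v i) = c ^ p * (starRingEnd ℂ c) ^ q * a v

theorem fderiv_type {p q : ℕ} {β : V → V [⋀^Fin k]→L[ℝ] ℂ} {y : V}
    (hβ : DifferentiableAt ℝ β y) (h : ∀ᶠ z in 𝓝 y, HasType p q (β z)) (w : V) :
    HasType p q (fderiv ℝ β y w) := by
  intro c v
  have key : ∀ u : Fin k → V, HasFDerivAt (fun z => β z u)
      ((ContinuousAlternatingMap.apply ℝ V ℂ u).comp (fderiv ℝ β y)) y :=
    fun u => (ContinuousAlternatingMap.apply ℝ V ℂ u).hasFDerivAt.comp y hβ.hasFDerivAt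
  have h1 := (key v).const_mul (c ^ p * (starRingEnd ℂ c) ^ q)
  have h2 := (key (fun i => c • v i)).congr_of_eventuallyEq
    (f₁ := fun z => c ^ p * (starRingEnd ℂ c) ^ q * β z v) (h.mono fun z hz => (hz c v).symm)
  have h3 := DFunLike.congr_fun (h2.unique h1) w
  simpa using h3

theorem extOp_type_del {p q : ℕ} {β : V → V [⋀^Fin k]→L[ℝ] ℂ} {y : V}
    (hβ : DifferentiableAt ℝ β y) (h : ∀ᶠ z in 𝓝 y, HasType p q (β z)) :
    HasType (p + 1) q (extOp (1 / 2) (-Complex.I / 2) β y) := by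
  intro c v
  simp only [extOp_apply, Finset.mul_sum]
  refine Finset.sum_congr rfl fun i _ => ?_
  have hr : (i.removeNth fun j => c • v j) = fun j => c • (i.removeNth v) j := rfl
  rw [hr, fderiv_type hβ h, fderiv_type hβ h]
  have hc : ∀ w : V, c • w = c.re • w + c.im • (Complex.I • w) := by
    intro w
    conv_lhs => rw [← Complex.re_add_im c, add_smul, mul_smul]
    rfl
  have hI : Complex.I • (c • v i) = c.re • (Complex.I • v i) + (-c.im) • v i := by
    rw [smul_comm, hc, smul_smul Complex.I, Complex.I_mul_I]
    simp
  rw [hI, hc (v i)]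
  simp only [map_add, map_smul, ContinuousAlternatingMap.add_apply,
    ContinuousAlternatingMap.smul_apply, zsmul_eq_mul, Complex.real_smul]
  conv_rhs => rw [pow_succ]; enter [1, 1, 2]; rw [← Complex.re_add_im c]
  push_cast
  linear_combination ((1 / 2 : ℂ) * (-1) ^ (i : ℕ) * c.im * c ^ p * (starRingEnd ℂ c) ^ q *
    (fderiv ℝ β y (Complex.I • v i)) (i.removeNth v)) * Complex.I_sq

theorem extOp_type_delBar {p q : ℕ} {β : V → V [⋀^Fin k]→L[ℝ] ℂ} {y : V}
    (hβ : DifferentiableAt ℝ β y) (h : ∀ᶠ z in 𝓝 y, HasType p q (β z)) :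
    HasType p (q + 1) (extOp (1 / 2) (Complex.I / 2) β y) := by
  intro c v
  simp only [extOp_apply, Finset.mul_sum]
  refine Finset.sum_congr rfl fun i _ => ?_
  have hr : (i.removeNth fun j => c • v j) = fun j => c • (i.removeNth v) j := rfl
  rw [hr, fderiv_type hβ h, fderiv_type hβ h]
  have hc : ∀ w : V, c • w = c.re • w + c.im • (Complex.I • w) := by
    intro w
    conv_lhs => rw [← Complex.re_add_im c, add_smul, mul_smul]
    rfl
  have hI : Complex.I • (c • v i) = c.re • (Complex.I • v i) + (-c.im) • v i := by
    rw [smul_comm, hc, smul_smul Complex.I, Complex.I_mul_I]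
    simp
  have hcc : starRingEnd ℂ c = c.re - c.im * Complex.I := by
    apply Complex.ext <;> simp
  rw [hI, hc (v i)]
  simp only [map_add, map_smul, ContinuousAlternatingMap.add_apply,
    ContinuousAlternatingMap.smul_apply, zsmul_eq_mul, Complex.real_smul]
  conv_rhs => rw [pow_succ]; enter [1, 2, 2]; rw [hcc]
  push_cast
  linear_combination ((1 / 2 : ℂ) * (-1) ^ (i : ℕ) * c.im * c ^ p * (starRingEnd ℂ c) ^ q *
    (fderiv ℝ β y (Complex.I • v i)) (i.removeNth v)) * Complex.I_sq

end Local

/-! ### Forms on a complex manifold `X` modelled on `E` -/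

section Mfd

variable (E : Type*) [NormedAddCommGroup E] [NormedSpace ℂ E]
  {X : Type*} [TopologicalSpace X] [ChartedSpace E X] {k : ℕ}

variable (X k) in
/-- Families of complex valued real alternating `k`-forms on the tangent spaces of `X`. -/
abbrev RawForm : Type _ := ∀ x : X, TangentSpace 𝓘(ℂ, E) x [⋀^Fin k]→L[ℝ] ℂ

variable {E}

/-- The differential at `y` of the inverse of the chart `e`. -/
def dSymm (e : OpenPartialHomeomorph X E) (y : E) : E →L[ℂ] TangentSpace 𝓘(ℂ, E) (e.symm y) :=
  mfderiv 𝓘(ℂ, E) 𝓘(ℂ, E) e.symm y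

/-- The differential at `x` of the chart `e`. -/
def dChart (e : OpenPartialHomeomorph X E) (x : X) : TangentSpace 𝓘(ℂ, E) x →L[ℂ] E :=
  mfderiv 𝓘(ℂ, E) 𝓘(ℂ, E) e x

/-- The expression of a form in the chart `e`: its pullback by the inverse of `e`. -/
def chartRep (α : RawForm E X k) (e : OpenPartialHomeomorph X E) (y : E) :
    E [⋀^Fin k]→L[ℝ] ℂ :=
  (α (e.symm y)).compContinuousLinearMap ((dSymm e y).restrictScalars ℝ)

/-- The operator `extOp a b` on `X`, computed at the point `x` in the chart at `x`. -/
def rawOp (a b : ℂ) (α : RawForm E X k) : RawForm E X (k + 1) := fun x =>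
  (extOp a b (chartRep α (chartAt E x)) (chartAt E x x)).compContinuousLinearMap
    ((dChart (chartAt E x) x).restrictScalars ℝ)

theorem chartRep_add (α β : RawForm E X k) (e : OpenPartialHomeomorph X E) :
    chartRep (α + β) e = chartRep α e + chartRep β e := rfl

theorem chartRep_smul (c : ℂ) (α : RawForm E X k) (e : OpenPartialHomeomorph X E) :
    chartRep (c • α) e = c • chartRep α e := rfl

variable (E X k) in
/-- The families of alternating forms that are smooth in every chart of the atlas. -/
def smoothForms : Submodule ℂ (RawForm E X k) where
  carrier := {α | ∀ e ∈ atlas E X, ContDiffOn ℝ ∞ (chartRep α e) e.target}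
  add_mem' hα hβ e he := by
    rw [chartRep_add]
    exact (hα e he).add (hβ e he)
  zero_mem' e _ := (contDiffOn_const (c := 0) : ContDiffOn ℝ ∞ _ e.target)
  smul_mem' c α hα e he := by
    rw [chartRep_smul]
    exact (hα e he).const_smul c

variable (E X k) in
/-- The complex vector space of smooth complex valued `k`-forms on `X`. -/
def Form : Type _ := smoothForms E X k

instance : AddCommGroup (Form E X k) := Submodule.addCommGroup (smoothForms E X k)

instance : Module ℂ (Form E X k) := Submodule.module (smoothForms E X k)

theorem form_ext {α β : Form E X k} (h : ∀ x v, α.1 x v = β.1 x v) : α = β :=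
  Subtype.ext (funext fun x => ContinuousAlternatingMap.ext (h x))

theorem chartRep_differentiableAt (α : Form E X k) {e : OpenPartialHomeomorph X E}
    (he : e ∈ atlas E X) {y : E} (hy : y ∈ e.target) : DifferentiableAt ℝ (chartRep α.1 e) y :=
  ((α.2 e he).contDiffAt (e.open_target.mem_nhds hy)).differentiableAt (by simp)

theorem hasType_chartRep {p q : ℕ} {α : RawForm E X k} (h : ∀ x, HasType p q (α x))
    (e : OpenPartialHomeomorph X E) (y : E) : HasType p q (chartRep α e y) := by
  intro c v
  have h1 : (fun i => dSymm e y (c • v i)) = fun i => c • dSymm e y (v i) :=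
    funext fun i => map_smul _ _ _
  exact (congrArg (α (e.symm y)) h1).trans (h _ c fun i => dSymm e y (v i))

variable [IsManifold 𝓘(ℂ, E) ω X]

theorem transition_contDiffAt {e e' : OpenPartialHomeomorph X E} (he : e ∈ atlas E X)
    (he' : e' ∈ atlas E X) {y : E} (hy : y ∈ e.target) (hy' : e.symm y ∈ e'.source) :
    ContDiffAt ℂ ω (e' ∘ e.symm) y := by
  have h := (mem_groupoid_of_pregroupoid.1
    (HasGroupoid.compatible (G := contDiffGroupoid ω 𝓘(ℂ, E)) he he')).1
  have h' : ContDiffOn ℂ ω (e' ∘ e.symm) (e.symm.trans e').source := by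
    simpa [contDiffPregroupoid, ContDiffOn] using h
  exact h'.contDiffAt ((e.symm.trans e').open_source.mem_nhds (by simp [hy, hy']))

theorem dChart_comp_dSymm {e e' : OpenPartialHomeomorph X E} (he : e ∈ atlas E X)
    (he' : e' ∈ atlas E X) {y : E} (hy : y ∈ e.target) (hy' : e.symm y ∈ e'.source) :
    (dChart e' (e.symm y)).comp (dSymm e y) = fderiv ℂ (e' ∘ e.symm) y := by
  rw [← mfderiv_eq_fderiv]
  exact (mfderiv_comp (I := 𝓘(ℂ, E)) (I' := 𝓘(ℂ, E)) (I'' := 𝓘(ℂ, E)) y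
    ((mdifferentiable_of_mem_atlas (I := 𝓘(ℂ, E)) he').mdifferentiableAt hy')
    ((mdifferentiable_of_mem_atlas (I := 𝓘(ℂ, E)) he).mdifferentiableAt_symm hy)).symm

theorem dSymm_eq {e e' : OpenPartialHomeomorph X E} (he : e ∈ atlas E X)
    (he' : e' ∈ atlas E X) {y : E} (hy : y ∈ e.target) (hy' : e.symm y ∈ e'.source) :
    (dSymm e y : E →L[ℂ] E) =
      (dSymm e' (e' (e.symm y)) : E →L[ℂ] E).comp (fderiv ℂ (e' ∘ e.symm) y) := by
  have hev : (e.symm : E → X) =ᶠ[𝓝 y] e'.symm ∘ (e' ∘ e.symm) := by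
    filter_upwards [(e.symm.trans e').open_source.mem_nhds
      (show y ∈ (e.symm.trans e').source by simp [hy, hy'])] with z hz
    have hz' : e.symm z ∈ e'.source := by simpa using hz.2
    simp [e'.left_inv hz']
  have h1 : (dSymm e y : E →L[ℂ] E) =
      mfderiv 𝓘(ℂ, E) 𝓘(ℂ, E) (e'.symm ∘ (e' ∘ e.symm)) y := hev.mfderiv_eq
  rw [h1, ← mfderiv_eq_fderiv]
  exact mfderiv_comp (I := 𝓘(ℂ, E)) (I' := 𝓘(ℂ, E)) (I'' := 𝓘(ℂ, E)) y
    ((mdifferentiable_of_mem_atlas (I := 𝓘(ℂ, E)) he').mdifferentiableAt_symm (e'.map_source hy'))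
    ((transition_contDiffAt he he' hy hy').differentiableAt (by simp)).mdifferentiableAt

theorem chartRep_eq (α : RawForm E X k) {e e' : OpenPartialHomeomorph X E} (he : e ∈ atlas E X)
    (he' : e' ∈ atlas E X) {y : E} (hy : y ∈ e.target) (hy' : e.symm y ∈ e'.source) :
    chartRep α e y = (chartRep α e' (e' (e.symm y))).compContinuousLinearMap
      (fderiv ℝ (e' ∘ e.symm) y) := by
  have hα : ∀ x x' : X, x = x' →
      ((α x : E [⋀^Fin k]→L[ℝ] ℂ) = (α x' : E [⋀^Fin k]→L[ℝ] ℂ)) := by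
    rintro x _ rfl; rfl
  have h1 := hα _ _ (e'.left_inv hy')
  ext v
  have h2 : ∀ w : E, (dSymm e y w : E) =
      (dSymm e' (e' (e.symm y)) (fderiv ℝ (e' ∘ e.symm) y w) : E) := by
    intro w
    rw [((transition_contDiffAt he he' hy hy').differentiableAt
      (by simp)).fderiv_restrictScalars ℝ]
    exact DFunLike.congr_fun (dSymm_eq he he' hy hy') w
  have h3 : (fun i => (dSymm e y (v i) : E)) =
      fun i => (dSymm e' (e' (e.symm y)) (fderiv ℝ (e' ∘ e.symm) y (v i)) : E) :=
    funext fun i => h2 (v i)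
  have h4 := congrArg (α (e.symm y) : E [⋀^Fin k]→L[ℝ] ℂ) h3
  have h5 := DFunLike.congr_fun h1
    (fun i => (dSymm e' (e' (e.symm y)) (fderiv ℝ (e' ∘ e.symm) y (v i)) : E))
  exact h4.trans h5.symm

/-- The operator `rawOp a b` is given by `extOp a b` in every chart. -/
theorem chartRep_rawOp (a b : ℂ) (α : Form E X k) {e : OpenPartialHomeomorph X E}
    (he : e ∈ atlas E X) {y : E} (hy : y ∈ e.target) :
    chartRep (rawOp a b α.1) e y = extOp a b (chartRep α.1 e) y := by
  set e' := chartAt E (e.symm y) with he'_def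
  have he' : e' ∈ atlas E X := chart_mem_atlas E _
  have hy' : e.symm y ∈ e'.source := mem_chart_source E _
  have hev : chartRep α.1 e =ᶠ[𝓝 y] fun z =>
      (chartRep α.1 e' ((e' ∘ e.symm) z)).compContinuousLinearMap (fderiv ℝ (e' ∘ e.symm) z) := by
    filter_upwards [(e.symm.trans e').open_source.mem_nhds
      (show y ∈ (e.symm.trans e').source by simp [hy, hy'])] with z hz
    exact chartRep_eq α.1 he he' (by simpa using hz.1) (by simpa using hz.2)
  have hf := transition_contDiffAt he he' hy hy'
  rw [extOp_congr hev, extOp_pullback a b (f := e' ∘ e.symm)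
    (chartRep_differentiableAt α he' (e'.map_source hy')) (hf.of_le le_top)]
  have h2 : ∀ w : E, dChart e' (e.symm y) (dSymm e y w) = fderiv ℝ (e' ∘ e.symm) y w := by
    intro w
    rw [(hf.differentiableAt (by simp)).fderiv_restrictScalars ℝ]
    exact DFunLike.congr_fun (dChart_comp_dSymm he he' hy hy') w
  ext v
  exact congrArg (extOp a b (chartRep α.1 e') (e' (e.symm y))) (funext fun i => h2 (v i))

theorem rawOp_mem (a b : ℂ) (α : Form E X k) : rawOp a b α.1 ∈ smoothForms E X (k + 1) := by
  intro e he
  have h1 : ContDiffOn ℝ ∞ (fderiv ℝ (chartRep α.1 e)) e.target :=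
    (α.2 e he).fderiv_of_isOpen e.open_target (by simp)
  have h2 : ContDiffOn ℝ ∞ (fun y => twist a b (fderiv ℝ (chartRep α.1 e) y)) e.target :=
    (h1.const_smul a).add ((h1.clm_comp contDiffOn_const).const_smul b)
  let A := alternatizeUncurryFinCLM (n := k) ℝ E ℂ
  have h3 : ContDiff ℝ ∞ (fun L => A L) := ContinuousLinearMap.contDiff (𝕜 := ℝ)
    (E := E →L[ℝ] E [⋀^Fin k]→L[ℝ] ℂ) (F := E [⋀^Fin (k + 1)]→L[ℝ] ℂ) A
  exact (h3.comp_contDiffOn h2).congr fun y hy => chartRep_rawOp a b α he hy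

/-- The operator on smooth forms given by `extOp a b` in every chart. -/
def formOp (a b : ℂ) : Form E X k →ₗ[ℂ] Form E X (k + 1) where
  toFun α := ⟨rawOp a b α.1, rawOp_mem a b α⟩
  map_add' α β := by
    refine form_ext fun x v => ?_
    have hα := chartRep_differentiableAt α (chart_mem_atlas E x) (mem_chart_target E x)
    have hβ := chartRep_differentiableAt β (chart_mem_atlas E x) (mem_chart_target E x)
    change extOp a b (chartRep α.1 _ + chartRep β.1 _) _ _ = extOp a b (chartRep α.1 _) _ _ +
      extOp a b (chartRep β.1 _) _ _
    simp only [extOp_apply, fderiv_add hα hβ, ← Finset.sum_add_distrib, ← smul_add]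
    refine Finset.sum_congr rfl fun i _ => congrArg _ ?_
    simp only [_root_.add_apply, ContinuousAlternatingMap.add_apply]
    ring
  map_smul' c α := by
    refine form_ext fun x v => ?_
    have hα := chartRep_differentiableAt α (chart_mem_atlas E x) (mem_chart_target E x)
    change extOp a b (c • chartRep α.1 _) _ _ = c * extOp a b (chartRep α.1 _) _ _
    simp only [extOp_apply, fderiv_const_smul hα, Finset.mul_sum, mul_smul_comm]
    refine Finset.sum_congr rfl fun i _ => congrArg _ ?_
    simp only [_root_.smul_apply, ContinuousAlternatingMap.smul_apply, smul_eq_mul]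
    ring

/-- The exterior derivative on smooth complex valued forms. -/
def d : Form E X k →ₗ[ℂ] Form E X (k + 1) := formOp 1 0

/-- The operator `∂`, given in every holomorphic chart by `∑ dz_j ∧ ∂/∂z_j`. -/
def del : Form E X k →ₗ[ℂ] Form E X (k + 1) := formOp (1 / 2) (-Complex.I / 2)

/-- The operator `∂bar`, given in every holomorphic chart by `∑ dzbar_j ∧ ∂/∂zbar_j`. -/
def delBar : Form E X k →ₗ[ℂ] Form E X (k + 1) := formOp (1 / 2) (Complex.I / 2)

theorem chartRep_d (α : Form E X k) {e : OpenPartialHomeomorph X E}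
    (he : e ∈ atlas E X) {y : E} (hy : y ∈ e.target) :
    chartRep (d α).1 e y = extDeriv (chartRep α.1 e) y :=
  (chartRep_rawOp 1 0 α he hy).trans (extOp_one_zero _ _)

theorem d_eq_del_add_delBar (α : Form E X k) : d α = del α + delBar α := by
  refine form_ext fun x v => ?_
  change extOp 1 0 (chartRep α.1 _) _ _ = extOp (1 / 2) (-Complex.I / 2) (chartRep α.1 _) _ _ +
    extOp (1 / 2) (Complex.I / 2) (chartRep α.1 _) _ _
  simp only [extOp_apply, ← Finset.sum_add_distrib, ← smul_add]
  refine Finset.sum_congr rfl fun i _ => congrArg _ ?_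
  ring

theorem hasType_del {p q : ℕ} {α : Form E X k} (h : ∀ x, HasType p q (α.1 x)) (x : X) :
    HasType (p + 1) q ((del α).1 x) := by
  intro c v
  have h1 : (fun i => dChart (chartAt E x) x (c • v i)) =
      fun i => c • dChart (chartAt E x) x (v i) := funext fun i => map_smul _ _ _
  exact (congrArg (extOp _ _ (chartRep α.1 (chartAt E x)) (chartAt E x x)) h1).trans
    (extOp_type_del
      (chartRep_differentiableAt α (chart_mem_atlas E x) (mem_chart_target E x))
      (.of_forall (hasType_chartRep h _)) c _)

theorem hasType_delBar {p q : ℕ} {α : Form E X k} (h : ∀ x, HasType p q (α.1 x)) (x : X) :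
    HasType p (q + 1) ((delBar α).1 x) := by
  intro c v
  have h1 : (fun i => dChart (chartAt E x) x (c • v i)) =
      fun i => c • dChart (chartAt E x) x (v i) := funext fun i => map_smul _ _ _
  exact (congrArg (extOp _ _ (chartRep α.1 (chartAt E x)) (chartAt E x x)) h1).trans
    (extOp_type_delBar
      (chartRep_differentiableAt α (chart_mem_atlas E x) (mem_chart_target E x))
      (.of_forall (hasType_chartRep h _)) c _)

variable (E X)

/-- The image of `d` in the `k`-forms. -/
def imD : (k : ℕ) → Submodule ℂ (Form E X k)
  | 0 => ⊥
  | _ + 1 => LinearMap.range d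

/-- The image of `∂ ∂bar` in the `k`-forms. -/
def imDelDelBar : (k : ℕ) → Submodule ℂ (Form E X k)
  | 0 => ⊥
  | 1 => ⊥
  | _ + 2 => LinearMap.range (del ∘ₗ delBar)

/-- `X` satisfies the `∂ ∂bar`-lemma: `ker ∂ ∩ ker ∂bar ∩ im d = im ∂ ∂bar` on the complex valued
smooth forms of every degree. -/
def DelDelBarLemma : Prop :=
  ∀ k : ℕ, LinearMap.ker (del : Form E X k →ₗ[ℂ] Form E X (k + 1)) ⊓
    LinearMap.ker (delBar : Form E X k →ₗ[ℂ] Form E X (k + 1)) ⊓ imD E X k = imDelDelBar E X k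

/-- The space of smooth `(p, q)`-forms. -/
def formPQ (p q : ℕ) : Submodule ℂ (Form E X (p + q)) where
  carrier := {α | ∀ x, HasType p q (α.1 x)}
  add_mem' {α β} hα hβ x c v := by
    change α.1 x _ + β.1 x _ = _ * (α.1 x v + β.1 x v)
    rw [hα x c v, hβ x c v, mul_add]
  zero_mem' _ _ _ := (mul_zero _).symm
  smul_mem' a α hα x c v := by
    change a * α.1 x _ = _ * (a * α.1 x v)
    rw [hα x c v, mul_left_comm]

/-- The space of `∂bar`-closed `(p, q)`-forms. -/
def dolbeaultZ (p q : ℕ) : Submodule ℂ (Form E X (p + q)) :=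
  formPQ E X p q ⊓ LinearMap.ker (delBar : Form E X (p + q) →ₗ[ℂ] Form E X (p + q + 1))

/-- The space of `∂bar`-exact `(p, q)`-forms: the image of `∂bar` on the `(p, q - 1)`-forms. -/
def dolbeaultB : (p q : ℕ) → Submodule ℂ (Form E X (p + q))
  | _, 0 => ⊥
  | p, q + 1 => (formPQ E X p q).map delBar

/-- The Dolbeault cohomology space `H^{p,q}` of `X` with respect to `∂bar`. -/
abbrev DolbeaultH (p q : ℕ) : Type _ :=
  dolbeaultZ E X p q ⧸ (dolbeaultB E X p q).submoduleOf (dolbeaultZ E X p q)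

variable {E X}

/-- A complex symplectic form: a `d`-closed smooth `(2, 0)`-form which is non-degenerate at every
point. A `(2, 0)`-form is a complex bilinear form on the complex vector space `T_x X`, identified
with the holomorphic tangent space by `v ↦ (v - i J v) / 2`. -/
structure IsComplexSymplectic (σ : Form E X 2) : Prop where
  type : σ ∈ formPQ E X 2 0
  closed : d σ = 0
  nondegenerate : ∀ (x : X) (v : TangentSpace 𝓘(ℂ, E) x),
    (∀ w : TangentSpace 𝓘(ℂ, E) x, σ.1 x ![v, w] = 0) → v = 0

variable (E X) in
/-- The set `Sp(X)` of the Dolbeault classes of complex symplectic forms. -/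
def Sp : Set (DolbeaultH E X 2 0) :=
  {c | ∃ σ : dolbeaultZ E X 2 0, IsComplexSymplectic (σ : Form E X 2) ∧
    Submodule.Quotient.mk σ = c}

end Mfd

end ComplexForms

end

/-! Two facts carry the theorem. First, under the ∂∂bar-lemma every ∂bar-closed (2,0)-form σ is
d-closed (`d_eq_zero_of_mem_dolbeaultZ`). Here dσ = ∂σ has type (3,0), and d(dσ) = 0 splits by type,
so ∂σ is killed by ∂ and ∂bar and equals some ∂∂bar β. As β is a 1-form, ∂∂bar β has only components
of types (2,1) and (1,2), so ∂σ = 0. Second, there are no non-zero ∂bar-exact (2,0)-forms, so each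
class has exactly one representative. Hence Sp(X) consists of the classes whose representative is
non-degenerate everywhere. This set is clearly stable under non-zero scalars, and it is open by
compactness of X (`isOpen_setOf_nondegenerate`): non-degeneracy is an open condition on a
finite-dimensional space, and the representative depends continuously on its class, uniformly on
compact subsets of charts. -/

noncomputable section

namespace ComplexForms

open ContinuousAlternatingMap

/-! ### Linear algebra of non-degenerate 2-forms -/

section Nondegenerate

variable {V W : Type*} [NormedAddCommGroup V] [NormedSpace ℂ V]
  [NormedAddCommGroup W] [NormedSpace ℂ W]

variable (V) in
/-- The set of non-degenerate complex valued real alternating 2-forms on `V`. -/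
def nondegenerateForms : Set (V [⋀^Fin 2]→L[ℝ] ℂ) :=
  {a | ∀ v, (∀ w, a ![v, w] = 0) → v = 0}

/-- Non-degeneracy of a 2-form is injectivity of its currying in the first variable, and injective
linear maps out of a finite-dimensional space form an open set. -/
theorem isOpen_nondegenerateForms [FiniteDimensional ℂ V] : IsOpen (nondegenerateForms V) := by
  have : FiniteDimensional ℝ V := FiniteDimensional.complexToReal V
  let C := (continuousMultilinearCurryLeftEquiv ℝ (fun _ : Fin 2 => V) ℂ)
  have hC : Continuous fun a : V [⋀^Fin 2]→L[ℝ] ℂ => C a.toContinuousMultilinearMap :=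
    C.continuous.comp (toContinuousMultilinearMapCLM (𝕜 := ℝ) (E := V) (F := ℂ)
      (ι := Fin 2) ℝ).continuous
  convert (ContinuousLinearMap.isOpen_injective (𝕜 := ℝ) (E := V)
    (F := ContinuousMultilinearMap ℝ (fun _ : Fin 1 => V) ℂ)).preimage hC using 1
  ext a
  simp only [nondegenerateForms, Set.mem_ofPred_eq, Set.mem_preimage]
  rw [injective_iff_map_eq_zero]
  refine forall_congr' fun v => imp_congr_left ⟨fun h => ?_, fun h w => ?_⟩
  · ext m
    have hm : (Fin.cons v m : Fin 2 → V) = ![v, m 0] := by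
      ext i; fin_cases i <;> rfl
    change a (Fin.cons v m) = 0
    rw [hm, h]
  · exact DFunLike.congr_fun h ![w]

theorem compContinuousLinearMap_mem_nondegenerateForms_iff {a : V [⋀^Fin 2]→L[ℝ] ℂ}
    (L : W →L[ℝ] V) (hL : Function.Bijective L) :
    a.compContinuousLinearMap L ∈ nondegenerateForms W ↔ a ∈ nondegenerateForms V := by
  have key : ∀ v w, a.compContinuousLinearMap L ![v, w] = a ![L v, L w] := fun v w => by
    rw [compContinuousLinearMap_apply]
    congr 1
    ext i; fin_cases i <;> rfl
  simp only [nondegenerateForms, Set.mem_ofPred_eq, key]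
  constructor
  · intro h v hv
    obtain ⟨v, rfl⟩ := hL.2 v
    rw [h v fun w => hv _, _root_.map_zero]
  · intro h v hv
    refine hL.1 ((h (L v) fun w => ?_).trans (_root_.map_zero L).symm)
    obtain ⟨w, rfl⟩ := hL.2 w
    exact hv w

end Nondegenerate

section Mfd

variable {E : Type*} [NormedAddCommGroup E] [NormedSpace ℂ E]
  {X : Type*} [TopologicalSpace X] [ChartedSpace E X] {k : ℕ}

/-! ### Separating forms by type -/

/-- The form obtained by letting `i` act on all the arguments of a form. -/
def mulIForm (α : Form E X k) : Form E X k :=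
  ⟨fun x => (α.1 x).compContinuousLinearMap
    ((Complex.I • ContinuousLinearMap.id ℂ (TangentSpace 𝓘(ℂ, E) x)).restrictScalars ℝ), by
    intro e he
    refine ((compContinuousLinearMapCLM (𝕜 := ℝ) (F := ℂ) (ι := Fin k)
      (cmul E Complex.I)).contDiff.comp_contDiffOn (α.2 e he)).congr fun y _ => ?_
    -- The inverse chart has a complex linear differential, so multiplication by `i` on tangent
    -- spaces becomes multiplication by `i` on `E`.
    ext v
    exact congrArg (α.1 (e.symm y)) (funext fun i => (map_smul (dSymm e y) _ _).symm)⟩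

/-- A real linear map to ℂ is the sum of its complex linear and antilinear parts, (β(v) ∓ i
β(iv))/2. Both are smooth because `mulIForm β` is. -/
theorem exists_oneForm_decomposition (β : Form E X 1) : ∃ β₁ β₂ : Form E X 1,
    (∀ x, HasType 1 0 (β₁.1 x)) ∧ (∀ x, HasType 0 1 (β₂.1 x)) ∧ β = β₁ + β₂ := by
  have hlin : ∀ (x : X) (c : ℂ) (v : Fin 1 → TangentSpace 𝓘(ℂ, E) x),
      β.1 x (fun i => c • v i) = c.re * β.1 x v + c.im * β.1 x (fun i => Complex.I • v i) := by
    intro x c v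
    have hup : ∀ w : TangentSpace 𝓘(ℂ, E) x, Function.update
        (fun _ : Fin 1 => (0 : TangentSpace 𝓘(ℂ, E) x)) 0 w = fun _ => w := fun w =>
      funext fun i => by rw [Subsingleton.elim i 0, Function.update_self]
    let L : TangentSpace 𝓘(ℂ, E) x →ₗ[ℝ] ℂ :=
      { toFun := fun w => β.1 x fun _ => w
        map_add' := fun w w' => by
          have := (β.1 x).map_update_add (fun _ => 0) 0 w w'
          simpa only [hup] using this
        map_smul' := fun r w => by
          have := (β.1 x).map_update_smul (fun _ => 0) 0 r w
          simpa only [hup, RingHom.id_apply] using this }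
    have hL : ∀ u : Fin 1 → TangentSpace 𝓘(ℂ, E) x, β.1 x u = L (u 0) := fun u =>
      congrArg (β.1 x) (funext fun i => by rw [Subsingleton.elim i 0])
    have hc : c • v 0 = c.re • v 0 + c.im • (Complex.I • v 0) := by
      conv_lhs => rw [← Complex.re_add_im c, add_smul, mul_smul]
      rfl
    rw [hL, hL, hL, hc, map_add, map_smul, map_smul, Complex.real_smul, Complex.real_smul]
  have hI : ∀ (x : X) (c : ℂ) (v : Fin 1 → TangentSpace 𝓘(ℂ, E) x),
      β.1 x (fun i => Complex.I • c • v i) =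
        c.re * β.1 x (fun i => Complex.I • v i) - c.im * β.1 x v := by
    intro x c v
    have h1 : (fun i => Complex.I • c • v i) = fun i => (Complex.I * c) • v i :=
      funext fun i => smul_smul _ _ _
    rw [h1, hlin]
    simp
    ring
  have hc : ∀ c : ℂ, c = c.re + c.im * Complex.I := fun c => (Complex.re_add_im c).symm
  have hcc : ∀ c : ℂ, starRingEnd ℂ c = c.re - c.im * Complex.I := fun c => by
    apply Complex.ext <;> simp
  refine ⟨(1 / 2 : ℂ) • (β + (-Complex.I) • mulIForm β), (1 / 2 : ℂ) • (β + Complex.I • mulIForm β),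
    fun x c v => ?_, fun x c v => ?_, ?_⟩
  · change (1 / 2 : ℂ) * (β.1 x _ + -Complex.I * β.1 x fun i => Complex.I • c • v i) =
      _ * ((1 / 2 : ℂ) * (β.1 x v + -Complex.I * β.1 x fun i => Complex.I • v i))
    rw [hlin, hI, pow_one, pow_zero, mul_one]
    conv_rhs => rw [hc c]
    linear_combination (1 / 2 : ℂ) * c.im * β.1 x (fun i => Complex.I • v i) * Complex.I_sq
  · change (1 / 2 : ℂ) * (β.1 x _ + Complex.I * β.1 x fun i => Complex.I • c • v i) =
      _ * ((1 / 2 : ℂ) * (β.1 x v + Complex.I * β.1 x fun i => Complex.I • v i))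
    rw [hlin, hI, pow_one, pow_zero, one_mul, hcc c]
    linear_combination (1 / 2 : ℂ) * c.im * β.1 x (fun i => Complex.I • v i) * Complex.I_sq
  · rw [← smul_add, add_add_add_comm, ← add_smul, neg_add_cancel, zero_smul, add_zero, smul_add,
      ← add_smul]
    norm_num

/-- A single scalar `c` on which the characters of the two types differ suffices to separate them:
compare the relation at `v` with the one at `c • v`. -/
theorem eq_zero_of_add_eq_zero_of_hasType {U : Type*} [AddCommGroup U] [Module ℂ U]
    [TopologicalSpace U] {p q p' q' : ℕ} {a b : U [⋀^Fin k]→L[ℝ] ℂ} (ha : HasType p q a)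
    (hb : HasType p' q' b) (hab : ∀ v, a v + b v = 0) {c : ℂ}
    (hc : c ^ p * starRingEnd ℂ c ^ q ≠ c ^ p' * starRingEnd ℂ c ^ q') (v : Fin k → U) :
    a v = 0 := by
  have h := hab fun i => c • v i
  rw [ha, hb, eq_neg_of_add_eq_zero_right (hab v)] at h
  have h' : (c ^ p * starRingEnd ℂ c ^ q - c ^ p' * starRingEnd ℂ c ^ q') * a v = 0 := by
    linear_combination h
  exact (mul_eq_zero.1 h').resolve_left (sub_ne_zero.2 hc)

/-! ### Openness of non-degeneracy inside one chart -/

/-- Restriction of the chart expression of a form to a compact subset of the chart. -/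
def chartRestrict (e : OpenPartialHomeomorph X E) (he : e ∈ atlas E X) {K : Set E}
    (hK : K ⊆ e.target) : Form E X k →ₗ[ℂ] C(K, E [⋀^Fin k]→L[ℝ] ℂ) where
  toFun α := ⟨K.domRestrict (chartRep α.1 e), ((α.2 e he).continuousOn.mono hK).domRestrict⟩
  map_add' _ _ := rfl
  map_smul' _ _ := rfl

/-- A set of `(2, 0)`-classes which is cut out by the non-degeneracy of their representatives on a
compact subset of a chart is open. -/
theorem isOpen_setOf_chartRep_nondegenerate [FiniteDimensional ℂ E]
    (e : OpenPartialHomeomorph X E) (he : e ∈ atlas E X)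
    {K : Set E} (hK : K ⊆ e.target) (hKc : IsCompact K) {M : Type*} [AddCommGroup M] [Module ℂ M]
    (φ : M →ₗ[ℂ] Form E X 2) :
    IsOpen[moduleTopology ℂ M] {m | ∀ y ∈ K, chartRep (φ m).1 e y ∈ nondegenerateForms E} := by
  let _ : TopologicalSpace M := moduleTopology ℂ M
  have : IsModuleTopology ℂ M := ⟨rfl⟩
  have : CompactSpace K := isCompact_iff_compactSpace.1 hKc
  -- For the module topology every linear map into a topological module is continuous, so no
  -- topology on the space of forms is needed. The target carries the sup norm topology, in which
  -- mapping the compact `K` into an open set is an open condition.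
  have hcont : Continuous ((chartRestrict e he hK).comp φ) :=
    IsModuleTopology.continuous_of_linearMap _
  convert (ContinuousMap.isOpen_setOfPred_mapsTo (X := K) isCompact_univ
    isOpen_nondegenerateForms).preimage hcont using 1
  ext m
  exact ⟨fun h y _ => h y y.2, fun h y hy => h (x := ⟨y, hy⟩) trivial⟩

/-! ### Closedness of ∂bar-closed (2,0)-forms -/

variable [IsManifold 𝓘(ℂ, E) ω X]

theorem d_d (α : Form E X k) : d (d α) = 0 := by
  refine form_ext fun x v => ?_
  have he := chart_mem_atlas E x
  have hx := mem_chart_target E x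
  have hev : chartRep (d α).1 (chartAt E x) =ᶠ[𝓝 (chartAt E x x)]
      extDeriv (chartRep α.1 (chartAt E x)) := by
    filter_upwards [(chartAt E x).open_target.mem_nhds hx] with y hy
    exact chartRep_d α he hy
  change extOp 1 0 (chartRep (d α).1 (chartAt E x)) (chartAt E x x) _ = 0
  rw [extOp_congr hev, extOp_one_zero, extDeriv_extDeriv_apply
    ((α.2 _ he).contDiffAt ((chartAt E x).open_target.mem_nhds hx))
      (by simpa using ENat.LEInfty.out (m := 2))]
  rfl

/-- The ∂∂bar-lemma writes ∂σ, of type (3,0), as ∂∂bar of a 1-form, which has no (3,0)-component. -/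
theorem d_eq_zero_of_mem_dolbeaultZ (hX : DelDelBarLemma E X) {σ : Form E X 2}
    (hσ : σ ∈ dolbeaultZ E X 2 0) : d σ = 0 := by
  have htype : ∀ x, HasType 2 0 (σ.1 x) := hσ.1
  have hbar : delBar σ = 0 := hσ.2
  have hd : d σ = del σ := by rw [d_eq_del_add_delBar, hbar, add_zero]
  have hdd : del (del σ) + delBar (del σ) = 0 := by
    rw [← d_eq_del_add_delBar, ← hd, d_d]
  have hdel : ∀ x, HasType 3 0 ((del σ).1 x) := hasType_del htype
  have hdd' : ∀ x v, (del (del σ)).1 x v + (delBar (del σ)).1 x v = 0 := fun x v =>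
    DFunLike.congr_fun (congrFun (congrArg Subtype.val hdd) x) v
  -- The scalar `i` acts by 1 on type (4,0) and by -1 on type (3,1).
  have hc : Complex.I ^ 4 * starRingEnd ℂ Complex.I ^ 0 ≠
      Complex.I ^ 3 * starRingEnd ℂ Complex.I ^ 1 := by
    norm_num [Complex.ext_iff, pow_succ]
  have h1 : del (del σ) = 0 := form_ext fun x v =>
    eq_zero_of_add_eq_zero_of_hasType (hasType_del hdel x) (hasType_delBar hdel x) (hdd' x) hc v
  have h2 : delBar (del σ) = 0 := by rwa [h1, zero_add] at hdd
  have hmem : del σ ∈ imDelDelBar E X 3 := by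
    rw [← hX 3]
    exact ⟨⟨h1, h2⟩, σ, hd⟩
  obtain ⟨β, hβ⟩ := hmem
  obtain ⟨β₁, β₂, hβ₁, hβ₂, rfl⟩ := exists_oneForm_decomposition β
  replace hβ : del (delBar β₁) + del (delBar β₂) = del σ := by
    rw [← hβ]; simp
  have ht₁ := fun x => hasType_del (hasType_delBar hβ₁) x
  have ht₂ := fun x => hasType_del (hasType_delBar hβ₂) x
  have hsum : ∀ x v, (del (delBar β₁)).1 x v + (del (delBar β₂)).1 x v = (del σ).1 x v :=
    fun x v => DFunLike.congr_fun (congrFun (congrArg Subtype.val hβ) x) v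
  rw [hd]
  refine form_ext fun x v => ?_
  change (del σ).1 x v = 0
  have e0 := hsum x v
  -- On types (2,1), (1,2), (3,0) the scalar `i` acts by i, -i, -i, so it only eliminates the
  -- (2,1)-part. The scalar 1 + i then separates (1,2) from (3,0): it acts by 2 - 2i and -2 + 2i,
  -- whose difference is 4 - 4i.
  have e1 := hsum x fun i => Complex.I • v i
  have e2 := hsum x fun i => (1 + Complex.I) • v i
  rw [ht₁, ht₂, hdel] at e1 e2
  simp only [map_add, map_one, Complex.conj_I] at e1 e2
  have hI := Complex.I_sq
  generalize (del (delBar β₁)).1 x v = a at *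
  generalize (del (delBar β₂)).1 x v = b at *
  generalize (del σ).1 x v = t at *
  subst e0
  have ha : a = 0 := by
    refine (mul_eq_zero.1 (?_ : (2 * Complex.I) * a = 0)).resolve_left (by simp)
    linear_combination e1 + 2 * a * Complex.I * hI
  subst ha
  have hne : 4 - 4 * Complex.I ≠ 0 := by norm_num [Complex.ext_iff]
  have hb : b = 0 := (mul_eq_zero.1 (by
    linear_combination e2 + 4 * b * hI : (4 - 4 * Complex.I) * b = 0)).resolve_left hne
  rw [hb, add_zero]

/-! ### Openness of non-degeneracy on the compact manifold -/

theorem dSymm_bijective {e : OpenPartialHomeomorph X E} (he : e ∈ atlas E X) {y : E}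
    (hy : y ∈ e.target) : Function.Bijective (dSymm e y) :=
  (mdifferentiable_of_mem_atlas (I := 𝓘(ℂ, E)) he).symm.mfderiv_bijective hy

theorem chartRep_mem_nondegenerateForms_iff (α : RawForm E X 2) {e : OpenPartialHomeomorph X E}
    (he : e ∈ atlas E X) {y : E} (hy : y ∈ e.target) :
    chartRep α e y ∈ nondegenerateForms E ↔
      ∀ v, (∀ w, α (e.symm y) ![v, w] = 0) → v = 0 :=
  compContinuousLinearMap_mem_nondegenerateForms_iff (V := E)
    ((dSymm e y).restrictScalars ℝ : E →L[ℝ] E) (dSymm_bijective he hy)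

/-- Finitely many compact coordinate balls cover X, so the set is a finite intersection of the open
sets obtained chart by chart. -/
theorem isOpen_setOf_nondegenerate [FiniteDimensional ℂ E] [CompactSpace X] {M : Type*} [AddCommGroup M] [Module ℂ M]
    (φ : M →ₗ[ℂ] Form E X 2) :
    IsOpen[moduleTopology ℂ M] {m | ∀ (x : X) (v : TangentSpace 𝓘(ℂ, E) x),
      (∀ w : TangentSpace 𝓘(ℂ, E) x, (φ m).1 x ![v, w] = 0) → v = 0} := by
  let _ : TopologicalSpace M := moduleTopology ℂ M
  have : FiniteDimensional ℝ E := FiniteDimensional.complexToReal E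
  have : ProperSpace E := FiniteDimensional.proper ℝ E
  have hr : ∀ x : X, ∃ r > 0, Metric.closedBall (chartAt E x x) r ⊆ (chartAt E x).target :=
    fun x => Metric.nhds_basis_closedBall.mem_iff.1
      ((chartAt E x).open_target.mem_nhds (mem_chart_target E x))
  choose r hr0 hr using hr
  have hnhds : ∀ x : X, (chartAt E x).source ∩
      chartAt E x ⁻¹' Metric.closedBall (chartAt E x x) (r x) ∈ 𝓝 x := fun x =>
    Filter.inter_mem (chart_source_mem_nhds E x)
      (((chartAt E x).continuousAt (mem_chart_source E x)).preimage_mem_nhds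
        (Metric.closedBall_mem_nhds _ (hr0 x)))
  obtain ⟨t, ht⟩ := CompactSpace.elim_nhds_subcover _ hnhds
  have hopen := isOpen_biInter_finset (s := t) fun x _ =>
    isOpen_setOf_chartRep_nondegenerate (chartAt E x) (chart_mem_atlas E x) (hr x)
      (isCompact_closedBall _ _) φ
  convert hopen using 1
  ext m
  simp only [Set.mem_ofPred_eq, Set.mem_iInter]
  constructor
  · intro h x _ y hy
    exact (chartRep_mem_nondegenerateForms_iff _ (chart_mem_atlas E x) (hr x hy)).2 (h _)
  · intro h z
    have hz : z ∈ ⋃ x ∈ t, (chartAt E x).source ∩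
      chartAt E x ⁻¹' Metric.closedBall (chartAt E x x) (r x) := ht ▸ Set.mem_univ z
    simp only [Set.mem_iUnion] at hz
    obtain ⟨x, hx, hzs, hzb⟩ := hz
    have := (chartRep_mem_nondegenerateForms_iff _ (chart_mem_atlas E x) (hr x hzb)).1
      (h x hx _ hzb)
    rwa [(chartAt E x).left_inv hzs] at this

end Mfd

end ComplexForms

end

/-! ### The theorem -/

/-- If a compact complex manifold `X` satisfies the `∂ ∂bar`-lemma, then `Sp(X)` is a cone in
`H^{2,0}` and it is open. The space `H^{2,0}` is finite dimensional, and its usual vector space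
topology is the module topology over `ℂ`. -/
theorem mainTheorem8 {E : Type*} [NormedAddCommGroup E] [NormedSpace ℂ E] [FiniteDimensional ℂ E]
    {X : Type*} [TopologicalSpace X] [T2Space X] [CompactSpace X] [ChartedSpace E X]
    [IsManifold 𝓘(ℂ, E) ω X] (hX : ComplexForms.DelDelBarLemma E X) :
    (∀ c ∈ ComplexForms.Sp E X, ∀ t : ℂ, t ≠ 0 → t • c ∈ ComplexForms.Sp E X) ∧
      IsOpen[moduleTopology ℂ (ComplexForms.DolbeaultH E X 2 0)] (ComplexForms.Sp E X) := by
  constructor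
  · rintro _ ⟨σ, hσ, rfl⟩ t ht
    refine ⟨t • σ, ⟨(t • σ).2.1, ?_, fun x v h => hσ.nondegenerate x v fun w => ?_⟩, rfl⟩
    · exact ComplexForms.d_eq_zero_of_mem_dolbeaultZ hX (t • σ).2
    · exact (mul_eq_zero.1 (h w)).resolve_left ht
  -- In bidegree (2,0) the exact forms are zero, so the quotient is the space of cocycles itself and
  -- `φ` sends a class to its unique representative.
  · have hB : (ComplexForms.dolbeaultB E X 2 0).submoduleOf (ComplexForms.dolbeaultZ E X 2 0) = ⊥ :=
      (Submodule.eq_bot_iff _).2 fun σ hσ => Subtype.ext hσ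
    let Q := Submodule.quotEquivOfEqBot _ hB
    let φ := (ComplexForms.dolbeaultZ E X 2 0).subtype.comp Q.toLinearMap
    convert ComplexForms.isOpen_setOf_nondegenerate φ using 1
    ext c
    constructor
    · rintro ⟨σ, hσ, rfl⟩
      exact hσ.nondegenerate
    -- Closedness is automatic by the ∂∂bar-lemma, so non-degeneracy alone makes the representative
    -- symplectic.
    · intro hc
      exact ⟨Q c, ⟨(Q c).2.1, ComplexForms.d_eq_zero_of_mem_dolbeaultZ hX (Q c).2, hc⟩,
        Q.symm_apply_apply c⟩
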